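/- For an integer $k\ge 2$, let the Ramsey number $r(k)$ be the least integer $N$ such that every coloring of the edges of the complete graph $K_N$ with two colors contains a monochromatic $K_k$, that is, a set of $k$ vertices all of whose pairs receive the same color. Then there exists an absolute constant $\delta>0$ such that \[ r(k)\le (4-\delta)^k \qquad\text{for all } k\ge 2. \] Concretely, $r(k)\le 3.993^k$ for all sufficiently large $k$. -/

import Mathlib

/-- `RamseyProperty k N`: every two-coloring of the edges of the complete graph on `N` vertices
contains a monochromatic `K_k`, that is, a set of `k` vertices all pairs of which receive
the same color. -/
def RamseyProperty (k N : ℕ) : Prop :=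
  ∀ c : SimpleGraph.TopEdgeLabeling (Fin N) (Fin 2),
    ∃ (i : Fin 2) (s : Finset (Fin N)), (c.labelGraph i).IsNClique k s

/-- The (diagonal) Ramsey number `r(k)`: the least `N` such that every two-coloring of the edges
of `K_N` contains a monochromatic `K_k`. Such an `N` exists by `ramseyNumber_isLeast`. -/
noncomputable def ramseyNumber (k : ℕ) : ℕ :=
  sInf {N : ℕ | RamseyProperty k N}

/-- Finite form of Ramsey's theorem for two graphs that cover all pairs of vertices. -/
theorem exists_ramsey_bound (k l : ℕ) : ∃ N : ℕ, ∀ (V : Type) (G H : SimpleGraph V),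
    (∀ x y : V, x ≠ y → G.Adj x y ∨ H.Adj x y) → ∀ s : Finset V, N ≤ s.card →
      (∃ t ⊆ s, G.IsNClique k t) ∨ (∃ t ⊆ s, H.IsNClique l t) := by
  classical
  induction k generalizing l with
  | zero => exact ⟨0, fun V G H _ s _ => Or.inl ⟨∅, by simp, by simp [SimpleGraph.isNClique_iff]⟩⟩
  | succ k ihk =>
    induction l with
    | zero =>
      exact ⟨0, fun V G H _ s _ => Or.inr ⟨∅, by simp, by simp [SimpleGraph.isNClique_iff]⟩⟩
    | succ l ihl =>
      obtain ⟨N₁, h₁⟩ := ihk (l + 1)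
      obtain ⟨N₂, h₂⟩ := ihl
      refine ⟨N₁ + N₂ + 1, fun V G H hGH s hs => ?_⟩
      obtain ⟨v, hv⟩ : s.Nonempty := by
        rw [← Finset.card_pos]; omega
      have hcard : s.card ≤ (s.filter (G.Adj v)).card + (s.filter (H.Adj v)).card + 1 := by
        have hsub : s ⊆ (s.filter (G.Adj v) ∪ s.filter (H.Adj v)) ∪ {v} := by
          intro x hx
          by_cases hxv : x = v
          · simp [hxv]
          · rcases hGH v x (Ne.symm hxv) with h | h <;> simp [hx, h]
        refine (Finset.card_le_card hsub).trans ((Finset.card_union_le _ _).trans ?_)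
        have := Finset.card_union_le (s.filter (G.Adj v)) (s.filter (H.Adj v))
        simp only [Finset.card_singleton]
        omega
      rcases (by omega : N₁ ≤ (s.filter (G.Adj v)).card ∨ N₂ ≤ (s.filter (H.Adj v)).card)
        with h | h
      · rcases h₁ V G H hGH _ h with ⟨t, hts, ht⟩ | ⟨t, hts, ht⟩
        · refine Or.inl ⟨insert v t, ?_, ht.insert fun b hb => (Finset.mem_filter.1 (hts hb)).2⟩
          exact Finset.insert_subset hv (hts.trans (Finset.filter_subset _ _))
        · exact Or.inr ⟨t, hts.trans (Finset.filter_subset _ _), ht⟩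
      · rcases h₂ V G H hGH _ h with ⟨t, hts, ht⟩ | ⟨t, hts, ht⟩
        · exact Or.inl ⟨t, hts.trans (Finset.filter_subset _ _), ht⟩
        · refine Or.inr ⟨insert v t, ?_, ht.insert fun b hb => (Finset.mem_filter.1 (hts hb)).2⟩
          exact Finset.insert_subset hv (hts.trans (Finset.filter_subset _ _))

/-- Ramsey's theorem: the set defining `r(k)` is nonempty, so `r(k)` is indeed its least
element. -/
theorem ramseyNumber_isLeast (k : ℕ) :
    IsLeast {N : ℕ | RamseyProperty k N} (ramseyNumber k) := by
  refine ⟨Nat.sInf_mem ?_, fun N hN => Nat.sInf_le hN⟩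
  obtain ⟨N, hN⟩ := exists_ramsey_bound k k
  refine ⟨N, fun c => ?_⟩
  have hcover : ∀ x y : Fin N, x ≠ y → (c.labelGraph 0).Adj x y ∨ (c.labelGraph 1).Adj x y := by
    intro x y hxy
    simp only [SimpleGraph.TopEdgeLabeling.labelGraph_adj]
    rcases (by omega : c.get x y hxy = 0 ∨ c.get x y hxy = 1) with h | h
    · exact Or.inl ⟨hxy, h⟩
    · exact Or.inr ⟨hxy, h⟩
  rcases hN (Fin N) _ _ hcover Finset.univ (by simp) with ⟨t, -, ht⟩ | ⟨t, -, ht⟩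
  · exact ⟨0, t, ht⟩
  · exact ⟨1, t, ht⟩

open Finset
open scoped Classical

/-! The proof runs a book algorithm on a pair (X, Y), initially both the whole vertex set, with `G`
red and `Gᶜ` blue. One colour has substantial excess over density p = 0.499; call it red. With S =
excess / |Y|, the potential `pot` is (|X| (S/|X|)^c)^3 |Y|.

Three moves shrink X. Deleting a vertex with few red neighbours in Y is free (`pot_erase`). A blue
book with spine of size b₀ replaces X by its pages and costs σ^b₀ (`pot_book`). A step at a centre x
replaces Y by the red neighbourhood of x and X by either its red neighbourhood, at cost x₀, or its
blue one, at cost σ (`pot_step`). Cauchy–Schwarz gives a centre for which the two sides together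
keep almost all of S (`exists_central`), so one of them keeps its share (`red_or_blue`). The centre
must have small blue degree; if too many vertices have large blue degree, they contain the spine of
a book (`exists_book`).

Once S is at most polynomial in k, the remaining potential forces Y to be large, and Erdős–Szekeres
inside Y with weights x₀, y₀ finishes (`exists_clique_of_pot`). Up to polynomial factors this needs
N^4 ≥ (x₀ σ y₀)^(-k), and (x₀ σ y₀)^(-1) ≈ 251.5 is below 3.993^4 ≈ 254.2. -/

namespace RamseyBook

variable {V : Type} {G : SimpleGraph V}

/-! ### Neighbourhoods and the Erdős–Szekeres bound -/

/-- The neighbours of `x` inside `S`. -/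
noncomputable def nbr (G : SimpleGraph V) (x : V) (S : Finset V) : Finset V := {v ∈ S | G.Adj x v}

theorem mem_nbr {x v : V} {S : Finset V} : v ∈ nbr G x S ↔ v ∈ S ∧ G.Adj x v := by
  simp [nbr]

theorem nbr_subset (x : V) (S : Finset V) : nbr G x S ⊆ S := filter_subset _ _

theorem notMem_nbr_self (x : V) (S : Finset V) : x ∉ nbr G x S := by simp [mem_nbr]

theorem card_nbr_add_card_nbr_compl {x : V} {S : Finset V} (hx : x ∈ S) :
    #(nbr G x S) + #(nbr Gᶜ x S) + 1 = #S := by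
  have h : S = insert x (nbr G x S ∪ nbr Gᶜ x S) := by
    ext v
    simp only [mem_insert, mem_union, mem_nbr, SimpleGraph.compl_adj]
    by_cases hv : v = x
    · simp [hv, hx]
    · have : x ≠ v := fun h => hv h.symm
      tauto
  have hd : Disjoint (nbr G x S) (nbr Gᶜ x S) := by
    rw [disjoint_left]
    intro v h1 h2
    rw [mem_nbr] at h1 h2
    exact ((SimpleGraph.compl_adj ..).1 h2.2).2 h1.2
  conv_rhs => rw [h]
  rw [card_insert_of_notMem (by simp [mem_nbr]), card_union_of_disjoint hd]

/-- The Erdős–Szekeres bound in exponential form. -/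
theorem exists_clique_or_indep (G : SimpleGraph V) {x y : ℝ} (hx : 0 < x) (hy : 0 < y)
    (hxy : x + y ≤ 1) (a b : ℕ) (S : Finset V) (h : x⁻¹ ^ a * y⁻¹ ^ b ≤ #S + 1) :
    (∃ t ⊆ S, G.IsNClique a t) ∨ ∃ t ⊆ S, Gᶜ.IsNClique b t := by
  induction a generalizing b S with
  | zero => exact Or.inl ⟨∅, by simp, by simp [SimpleGraph.isNClique_iff]⟩
  | succ a iha =>
    induction b generalizing S with
    | zero => exact Or.inr ⟨∅, by simp, by simp [SimpleGraph.isNClique_iff]⟩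
    | succ b ihb =>
      have hx1 : 1 < x⁻¹ := (one_lt_inv₀ hx).2 (by linarith)
      have hy1 : 1 < y⁻¹ := (one_lt_inv₀ hy).2 (by linarith)
      obtain ⟨v, hv⟩ : S.Nonempty := by
        rw [← card_pos]
        have : 1 < x⁻¹ ^ (a + 1) * y⁻¹ ^ (b + 1) :=
          one_lt_mul_of_lt_of_le (one_lt_pow₀ hx1 (by omega)) (one_le_pow₀ hy1.le)
        have : (0 : ℝ) < #S := by linarith
        exact_mod_cast this
      set Z := x⁻¹ ^ (a + 1) * y⁻¹ ^ (b + 1) with hZ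
      have hZ0 : 0 < Z := by positivity
      have e1 : x⁻¹ ^ a * y⁻¹ ^ (b + 1) = x * Z := by rw [hZ, pow_succ _ a]; field_simp
      have e2 : x⁻¹ ^ (a + 1) * y⁻¹ ^ b = y * Z := by rw [hZ, pow_succ _ b]; field_simp
      have hc : (#(nbr G v S) : ℝ) + #(nbr Gᶜ v S) + 1 = #S := by
        exact_mod_cast card_nbr_add_card_nbr_compl (G := G) hv
      -- The `+ 1` in the hypothesis makes the induction close: the two neighbourhoods, each with
      -- its own `+ 1`, add up to exactly `#S + 1 ≥ Z`.
      by_cases h1 : x * Z ≤ #(nbr G v S) + 1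
      · rcases iha (b + 1) (nbr G v S) (e1 ▸ h1) with ⟨t, hts, ht⟩ | ⟨t, hts, ht⟩
        · exact Or.inl ⟨insert v t, insert_subset hv (hts.trans (nbr_subset _ _)),
            ht.insert fun w hw => (mem_nbr.1 (hts hw)).2⟩
        · exact Or.inr ⟨t, hts.trans (nbr_subset _ _), ht⟩
      · have h2 : y * Z ≤ #(nbr Gᶜ v S) + 1 := by
          have : (x + y) * Z ≤ 1 * Z := by gcongr
          linarith
        rcases ihb (nbr Gᶜ v S) (e2 ▸ h2) with ⟨t, hts, ht⟩ | ⟨t, hts, ht⟩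
        · exact Or.inl ⟨t, hts.trans (nbr_subset _ _), ht⟩
        · exact Or.inr ⟨insert v t, insert_subset hv (hts.trans (nbr_subset _ _)),
            ht.insert fun w hw => (mem_nbr.1 (hts hw)).2⟩

/-! ### Excess and the choice of a centre -/

/-- The excess of the number of edges between `X` and `Y` over density `p`. -/
noncomputable def excess (G : SimpleGraph V) (p : ℝ) (X Y : Finset V) : ℝ :=
  ∑ x ∈ X, ((#(nbr G x Y) : ℝ) - p * #Y)

theorem excess_le {p : ℝ} (hp : 0 ≤ p) (X Y : Finset V) : excess G p X Y ≤ #X * #Y := by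
  rw [excess, ← nsmul_eq_mul]
  refine sum_le_card_nsmul _ _ _ fun x _ => ?_
  have : (#(nbr G x Y) : ℝ) ≤ #Y := by exact_mod_cast card_le_card (nbr_subset x Y)
  have : 0 ≤ p * #Y := by positivity
  linarith

theorem sum_card_nbr_nbr (X Y : Finset V) :
    ∑ x ∈ X, ∑ z ∈ X, (#(nbr G z (nbr G x Y)) : ℝ) = ∑ y ∈ Y, (#(nbr G y X) : ℝ) ^ 2 := by
  have h : ∀ x z, (#(nbr G z (nbr G x Y)) : ℝ)
      = ∑ y ∈ Y, (if G.Adj y x then 1 else 0) * (if G.Adj y z then 1 else 0) := by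
    intro x z
    simp only [nbr, card_filter, sum_filter, Nat.cast_sum, sum_filter]
    refine sum_congr rfl fun y _ => ?_
    simp only [G.adj_comm y]
    split_ifs <;> simp_all
  simp only [h]
  rw [sum_congr rfl fun x _ => sum_comm, sum_comm]
  refine sum_congr rfl fun y _ => ?_
  rw [← sum_mul_sum, sq]
  simp [nbr]

theorem sum_card_nbr_comm (X Y : Finset V) :
    ∑ x ∈ X, (#(nbr G x Y) : ℝ) = ∑ y ∈ Y, (#(nbr G y X) : ℝ) := by
  simp only [nbr, card_filter, Nat.cast_sum]
  rw [sum_comm]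
  simp [G.adj_comm]

/-- The terms in p agree on both sides; what remains is Cauchy–Schwarz for the degrees of the
vertices of Y into X. -/
theorem excess_mul_sum_le (p : ℝ) (X Y : Finset V) :
    excess G p X Y * ∑ x ∈ X, (#(nbr G x Y) : ℝ) ≤ #Y * ∑ x ∈ X, excess G p X (nbr G x Y) := by
  simp only [excess, sum_sub_distrib, sum_const, nsmul_eq_mul]
  rw [sum_card_nbr_nbr, ← mul_sum, ← mul_sum]
  have h := sq_sum_le_card_mul_sum_sq (s := Y) (f := fun y => (#(nbr G y X) : ℝ))
  rw [← sum_card_nbr_comm] at h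
  linarith

theorem excess_le_add {p : ℝ} {x : V} {X : Finset V} (hx : x ∈ X)
    (hp : 0 ≤ p) (Z : Finset V) :
    excess G p X Z ≤ excess G p (nbr G x X) Z + excess G p (nbr Gᶜ x X) Z + #Z := by
  have h : X = insert x (nbr G x X ∪ nbr Gᶜ x X) := by
    ext v
    simp only [mem_insert, mem_union, mem_nbr, SimpleGraph.compl_adj]
    by_cases hv : v = x
    · simp [hv, hx]
    · have : x ≠ v := fun h => hv h.symm
      tauto
  have hd : Disjoint (nbr G x X) (nbr Gᶜ x X) := by
    rw [disjoint_left]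
    intro v h1 h2
    rw [mem_nbr] at h1 h2
    exact ((SimpleGraph.compl_adj ..).1 h2.2).2 h1.2
  have h1 : (#(nbr G x Z) : ℝ) ≤ #Z := by exact_mod_cast card_le_card (nbr_subset x Z)
  have : 0 ≤ p * #Z := mul_nonneg hp (Nat.cast_nonneg _)
  conv_lhs => rw [excess, h]
  rw [sum_insert (by simp [notMem_nbr_self]), sum_union hd]
  simp only [excess]
  linarith

/-- Some vertex outside the small set `W` loses almost nothing of the excess when it is used
as the centre of a step. -/
theorem exists_central {p η : ℝ} (hp : 0 < p) (hη : 0 < η) (hη1 : η ≤ 1)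
    {X Y W : Finset V} (hW : W ⊆ X)
    (hY : Y.Nonempty)
    (hdeg : ∀ x ∈ X, p * #Y ≤ #(nbr G x Y))
    (hlarge : #W * #Y < (η * (excess G p X Y / #Y) - 1) * p * #Y) :
    ∃ x ∈ X \ W, (1 - η) * (excess G p X Y / #Y) * #(nbr G x Y) ≤
      excess G p (nbr G x X) (nbr G x Y) + excess G p (nbr Gᶜ x X) (nbr G x Y) := by
  by_contra! hcon
  set E := excess G p X Y / #Y with hE
  have hm : (0 : ℝ) < #Y := by exact_mod_cast hY.card_pos
  have hEY : excess G p X Y = E * #Y := by rw [hE]; field_simp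
  have hq : 0 < η * E - 1 := by
    by_contra! h
    have h0 : (0 : ℝ) ≤ #W * #Y := mul_nonneg (Nat.cast_nonneg _) (Nat.cast_nonneg _)
    have : (η * E - 1) * p * #Y ≤ 0 :=
      mul_nonpos_of_nonpos_of_nonneg (mul_nonpos_of_nonpos_of_nonneg h hp.le) hm.le
    linarith
  have hE0 : 0 < E := by
    by_contra! h
    have := mul_nonpos_of_nonneg_of_nonpos hη.le h
    linarith
  have hX : (0 : ℝ) < #X := by
    rw [Nat.cast_pos, card_pos, nonempty_iff_ne_empty]
    rintro rfl
    simp [hE, excess] at hE0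
  set e := ∑ x ∈ X, (#(nbr G x Y) : ℝ) with he
  have h1 : E * e ≤ ∑ x ∈ X, excess G p X (nbr G x Y) := by
    have := excess_mul_sum_le (G := G) p X Y
    rw [hEY] at this
    refine le_of_mul_le_mul_left ?_ hm
    rw [← he] at this
    linarith
  have he0 : p * #Y * #X ≤ e := by
    rw [he, mul_comm, ← nsmul_eq_mul]
    exact card_nsmul_le_sum _ _ _ hdeg
  have h2 : ∑ x ∈ X, excess G p X (nbr G x Y)
      ≤ ∑ x ∈ X, (((1 - η) * E + 1) * #(nbr G x Y) + if x ∈ W then (#X : ℝ) * #Y else 0) := by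
    refine sum_le_sum fun x hx => ?_
    -- Vertices of W get the trivial bound |X||Y|; the others lose, besides the failed inequality,
    -- only the contribution of x itself. `hlarge` says that the slack η outweighs both losses.
    have hs : (#(nbr G x Y) : ℝ) ≤ #Y := by exact_mod_cast card_le_card (nbr_subset x Y)
    split_ifs with hxW
    · have h3 := excess_le (G := G) hp.le X (nbr G x Y)
      have h4 : (#X : ℝ) * #(nbr G x Y) ≤ #X * #Y :=
        mul_le_mul_of_nonneg_left hs (Nat.cast_nonneg _)
      have h5 : 0 ≤ ((1 - η) * E + 1) * #(nbr G x Y) := by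
        have : 0 ≤ (1 - η) * E := mul_nonneg (by linarith) hE0.le
        exact mul_nonneg (by linarith) (Nat.cast_nonneg _)
      linarith
    · have := hcon x (mem_sdiff.2 ⟨hx, hxW⟩)
      have := excess_le_add (G := G) hx hp.le (nbr G x Y)
      linarith
  rw [sum_add_distrib, ← mul_sum, ← he, ← sum_filter, sum_const, nsmul_eq_mul,
    filter_mem_eq_inter, inter_eq_right.2 hW] at h2
  have h6 := mul_le_mul_of_nonneg_left he0 hq.le
  have h7 := mul_lt_mul_of_pos_right hlarge hX
  linarith

/-! ### Books -/

theorem sum_card_common_nbr (H : SimpleGraph V) (X S : Finset V) (b : ℕ) :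
    ∑ f : Fin b → S, #{v ∈ X | ∀ i, H.Adj (f i) v} = ∑ v ∈ X, #(nbr H v S) ^ b := by
  simp only [card_filter]
  rw [sum_comm]
  refine sum_congr rfl fun v _ => ?_
  have h : nbr H v S = S.filter fun s => H.Adj s v := by
    ext s; simp [mem_nbr, H.adj_comm]
  have h2 : #(nbr H v S) = ∑ s : S, if H.Adj s v then 1 else 0 := by
    rw [h, card_filter, ← sum_coe_sort S]
  rw [h2, ← Fin.prod_const, prod_univ_sum]
  simp only [Fintype.piFinset_univ, prod_ite_zero, prod_const_one, mem_univ, true_imp_iff]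

/-- By Bernoulli; it bounds the share of non-injective b-tuples by b²/M. -/
theorem pow_mul_one_sub_le_descFactorial {M b : ℕ} (hM : 0 < M) (hbM : b ≤ M) :
    (M : ℝ) ^ b * (1 - b ^ 2 / M) ≤ M.descFactorial b := by
  have hM' : (0 : ℝ) < M := by exact_mod_cast hM
  have h1 : (((M + 1 - b : ℕ) : ℝ)) ^ b ≤ M.descFactorial b := by
    exact_mod_cast Nat.pow_sub_le_descFactorial M b
  have hb1 : (b : ℝ) / M ≤ 1 := (div_le_one hM').2 (by exact_mod_cast hbM)
  have h2 := one_add_mul_le_pow (a := -(b / M : ℝ)) (by linarith) b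
  have h3 : (M : ℝ) * (1 + -(b / M)) = M - b := by field_simp; ring
  calc (M : ℝ) ^ b * (1 - b ^ 2 / M) = M ^ b * (1 + b * -(b / M)) := by ring
    _ ≤ M ^ b * (1 + -(b / M)) ^ b := by gcongr
    _ = (M - b) ^ b := by rw [← mul_pow, h3]
    _ ≤ ((M + 1 - b : ℕ) : ℝ) ^ b := by
        have : (b : ℝ) ≤ M := by exact_mod_cast hbM
        rw [Nat.cast_sub (by omega)]
        push_cast
        gcongr
        linarith
    _ ≤ _ := h1

/-- Among many vertices of large degree into `X`, some `b` have many common neighbours. -/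
theorem exists_book (H : SimpleGraph V) {μ : ℝ} (hμ : 0 < μ) (hμ1 : μ ≤ 1) {X S : Finset V}
    (hX : X.Nonempty) {b : ℕ} (hb : 0 < b) (hdeg : ∀ s ∈ S, μ * #X ≤ #(nbr H s X))
    (hS : 2 * (b : ℝ) ^ 2 < μ ^ b * #S) :
    ∃ S' ⊆ S, #S' = b ∧ ∃ T ⊆ X, (∀ v ∈ T, ∀ s ∈ S', H.Adj s v) ∧ μ ^ b / 2 * #X ≤ #T := by
  have hn : (0 : ℝ) < #X := by exact_mod_cast hX.card_pos
  have hb' : (1 : ℝ) ≤ b := by exact_mod_cast hb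
  have hM : (0 : ℝ) < #S := by
    by_contra! h
    have : μ ^ b * #S ≤ 0 := mul_nonpos_of_nonneg_of_nonpos (by positivity) h
    nlinarith
  have hbM : b ≤ #S := by
    have : μ ^ b * #S ≤ 1 * #S :=
      mul_le_mul_of_nonneg_right (pow_le_one₀ hμ.le hμ1) hM.le
    have : (b : ℝ) ≤ #S := by nlinarith
    exact_mod_cast this
  suffices h : ∃ f : Fin b → S, Function.Injective f ∧
      μ ^ b / 2 * #X ≤ #{v ∈ X | ∀ i, H.Adj (f i) v} by
    obtain ⟨f, hf, h⟩ := h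
    refine ⟨univ.image fun i => (f i : V), ?_, ?_, _, filter_subset _ _, fun v hv s hs => ?_, h⟩
    · intro v hv
      obtain ⟨i, -, rfl⟩ := mem_image.1 hv
      exact (f i).2
    · exact (card_image_of_injective _ (Subtype.val_injective.comp hf)).trans (by simp)
    · obtain ⟨i, -, rfl⟩ := mem_image.1 hs
      exact (mem_filter.1 hv).2 i
  by_contra! hcon
  -- By the power mean inequality, a random b-tuple from S has on average at least μ^b |X| common
  -- neighbours; non-injective tuples account for less than half of this.
  have h1 : (#X : ℝ) * (#S * μ) ^ b ≤ ∑ f : Fin b → S, (#{v ∈ X | ∀ i, H.Adj (f i) v} : ℝ) := by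
    have e := sum_card_common_nbr H X S b
    have e' : ∑ f : Fin b → S, (#{v ∈ X | ∀ i, H.Adj (f i) v} : ℝ)
        = ∑ v ∈ X, (#(nbr H v S) : ℝ) ^ b := by exact_mod_cast e
    rw [e']
    obtain ⟨d, rfl⟩ : ∃ d, b = d + 1 := ⟨b - 1, by omega⟩
    have h2 := pow_sum_div_card_le_sum_pow (s := X) (f := fun v => (#(nbr H v S) : ℝ))
      (fun _ _ => Nat.cast_nonneg _) d
    refine le_trans ?_ h2
    rw [← sum_card_nbr_comm]
    have h3 : #S * (μ * #X) ≤ ∑ s ∈ S, (#(nbr H s X) : ℝ) := by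
      rw [← nsmul_eq_mul]
      exact card_nsmul_le_sum _ _ _ hdeg
    rw [le_div_iff₀ (by positivity)]
    calc (#X : ℝ) * (#S * μ) ^ (d + 1) * #X ^ d = (#S * (μ * #X)) ^ (d + 1) := by ring
      _ ≤ _ := by gcongr
  have h2 : ∑ f : Fin b → S, (#{v ∈ X | ∀ i, H.Adj (f i) v} : ℝ)
      ≤ ∑ f : Fin b → S, (μ ^ b / 2 * #X + if Function.Injective f then 0 else (#X : ℝ)) := by
    refine sum_le_sum fun f _ => ?_
    have h0 : 0 ≤ μ ^ b / 2 * #X := by positivity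
    split_ifs with hf
    · linarith [hcon f hf]
    · have : (#{v ∈ X | ∀ i, H.Adj (f i) v} : ℝ) ≤ #X := by
        exact_mod_cast card_le_card (filter_subset _ _)
      linarith
  have hcard : #{f : Fin b → S | ¬ Function.Injective f} + (#S).descFactorial b = #S ^ b := by
    have e1 : #{f : Fin b → S | Function.Injective f} = (#S).descFactorial b := by
      rw [← Fintype.card_subtype,
        Fintype.card_congr (Equiv.subtypeInjectiveEquivEmbedding (Fin b) S),
        Fintype.card_embedding_eq, Fintype.card_fin, Fintype.card_coe]
    rw [← e1, add_comm, card_filter_add_card_filter_not, card_univ]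
    simp
  have hcard' : (#{f : Fin b → S | ¬ Function.Injective f} : ℝ) + (#S).descFactorial b
      = (#S : ℝ) ^ b := by exact_mod_cast hcard
  have h3 : ∑ f : Fin b → S, (μ ^ b / 2 * #X + if Function.Injective f then 0 else (#X : ℝ))
      = #S ^ b * (μ ^ b / 2 * #X) + #{f : Fin b → S | ¬ Function.Injective f} * #X := by
    rw [sum_add_distrib, sum_const, card_univ, nsmul_eq_mul]
    congr 1
    · simp
    · rw [← nsmul_eq_mul, ← sum_const, sum_filter]
      refine sum_congr rfl fun f _ => ?_
      split_ifs <;> simp_all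
  rw [h3] at h2
  have h4 := pow_mul_one_sub_le_descFactorial (by exact_mod_cast hM : 0 < #S) hbM
  have h5 : (b : ℝ) ^ 2 / #S < μ ^ b / 2 := by
    rw [div_lt_iff₀ hM]; linarith
  have h6 : (#S : ℝ) ^ b * (b ^ 2 / #S) < #S ^ b * (μ ^ b / 2) := by gcongr
  have h7 : (#{f : Fin b → S | ¬ Function.Injective f} : ℝ) * #X
      < #S ^ b * (μ ^ b / 2) * #X := by
    refine mul_lt_mul_of_pos_right ?_ hn
    linarith
  have h8 : (#X : ℝ) * (#S * μ) ^ b = #S ^ b * (μ ^ b / 2) * #X + #S ^ b * (μ ^ b / 2) * #X := by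
    rw [mul_pow]; ring
  linarith

/-! ### The potential and its behaviour under each move -/

/-- Bernoulli's inequality (1 + (z/r - 1)/c)^c ≥ z/r with r = n'/n. The loss is z A^c whatever r is:
a set smaller than the fraction z is compensated by higher density. -/
theorem mul_mul_pow_le_mul_div_pow {n S n' S' z A : ℝ} {c : ℕ} (hc : 1 ≤ c) (hn : 0 < n)
    (hS : 0 ≤ S) (hn' : 0 < n') (hz : 0 ≤ z) (hA : 0 ≤ A)
    (h : A * (z / c + (1 - 1 / c) * (n' / n)) * S ≤ S') :
    z * A ^ c * (n * (S / n) ^ c) ≤ n' * (S' / n') ^ c := by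
  have hc' : (1 : ℝ) ≤ c := by exact_mod_cast hc
  have hr : 0 < n' / n := by positivity
  set r := n' / n with hrdef
  have hn'r : n' = r * n := by rw [hrdef]; field_simp
  have h0 : 0 ≤ 1 + 1 / c * (z / r - 1) := by
    have : 1 + 1 / c * (z / r - 1) = (1 - 1 / c) + 1 / c * (z / r) := by ring
    rw [this]
    have : 1 / (c : ℝ) ≤ 1 := (div_le_one (by linarith)).2 hc'
    have : 0 ≤ 1 / (c : ℝ) * (z / r) := by positivity
    linarith
  have h1 : z / r ≤ (1 + 1 / c * (z / r - 1)) ^ c := by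
    have hb := one_add_mul_le_pow (a := 1 / (c : ℝ) * (z / r - 1)) (by linarith) c
    have e : 1 + (c : ℝ) * (1 / c * (z / r - 1)) = z / r := by field_simp; ring
    linarith
  have h2 : A * (1 + 1 / c * (z / r - 1)) * (S / n) ≤ S' / n' := by
    rw [le_div_iff₀ hn']
    refine le_trans (le_of_eq ?_) h
    rw [hn'r]
    field_simp
    ring
  calc z * A ^ c * (n * (S / n) ^ c) = n' * (A ^ c * (z / r) * (S / n) ^ c) := by
        rw [hn'r]; field_simp
    _ ≤ n' * (A ^ c * (1 + 1 / c * (z / r - 1)) ^ c * (S / n) ^ c) := by gcongr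
    _ = n' * (A * (1 + 1 / c * (z / r - 1)) * (S / n)) ^ c := by rw [mul_pow, mul_pow]
    _ ≤ _ := by gcongr

theorem isNClique_union {H : SimpleGraph V} {i j : ℕ} {s t : Finset V} (hs : H.IsNClique i s)
    (ht : H.IsNClique j t) (hst : ∀ a ∈ s, ∀ b ∈ t, H.Adj a b) : H.IsNClique (i + j) (s ∪ t) := by
  rw [SimpleGraph.isNClique_iff] at *
  refine ⟨?_, ?_⟩
  · intro a ha b hb hab
    simp only [coe_union, Set.mem_union, mem_coe] at ha hb
    rcases ha with ha | ha <;> rcases hb with hb | hb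
    · exact hs.1 ha hb hab
    · exact hst a ha b hb
    · exact (hst b hb a ha).symm
    · exact ht.1 ha hb hab
  · rw [card_union_of_disjoint, hs.2, ht.2]
    rw [disjoint_left]
    intro a ha hb
    exact H.loopless.irrefl a (hst a ha a hb)

/-- The potential of a pair `(X, Y)`: it weighs the sizes of `X` and `Y` against the excess of the
edge density between them over `p`. -/
noncomputable def pot (G : SimpleGraph V) (p : ℝ) (c : ℕ) (X Y : Finset V) : ℝ :=
  (#X * (excess G p X Y / #Y / #X) ^ c) ^ 3 * #Y

theorem pot_le {p : ℝ} (hp : 0 ≤ p) {c : ℕ} (hc : 1 ≤ c) {X Y : Finset V} {D : ℝ}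
    (h0 : 0 ≤ excess G p X Y) (hD : excess G p X Y / #Y ≤ D) : pot G p c X Y ≤ D ^ 3 * #Y := by
  have hS : 0 ≤ excess G p X Y / #Y := div_nonneg h0 (Nat.cast_nonneg _)
  have hle : excess G p X Y / #Y ≤ #X :=
    div_le_of_le_mul₀ (Nat.cast_nonneg _) (Nat.cast_nonneg _) (excess_le hp X Y)
  set S := excess G p X Y / #Y
  have hX0 : (0 : ℝ) ≤ #X := Nat.cast_nonneg _
  have h1 : #X * (S / #X) ^ c ≤ S := by
    rcases hX0.eq_or_lt with h | h
    · rw [← h]; simpa using hS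
    · calc #X * (S / #X) ^ c ≤ #X * (S / #X) := by
            refine mul_le_mul_of_nonneg_left ?_ h.le
            exact pow_le_of_le_one (by positivity) ((div_le_one h).2 hle) (by omega)
        _ = S := by field_simp
  rw [pot]
  gcongr
  exact h1.trans hD

theorem card_pos_of_excess_pos {X Y : Finset V} {p : ℝ} (h : 0 < excess G p X Y) :
    (0 : ℝ) < #X ∧ (0 : ℝ) < #Y := by
  constructor
  · rw [Nat.cast_pos, card_pos, nonempty_iff_ne_empty]
    rintro rfl
    simp [excess] at h
  · rw [Nat.cast_pos, card_pos, nonempty_iff_ne_empty]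
    rintro rfl
    simp [excess, nbr] at h

theorem pot_step {p : ℝ} {c : ℕ} {X Y X' Y' : Finset V} {z A q ρ : ℝ} (hc : 1 ≤ c)
    (h : 0 < excess G p X Y) (h' : 0 < excess G p X' Y') (hz : 0 ≤ z) (hA : 0 ≤ A) (hq : 0 ≤ q)
    (hY : q * #Y ≤ #Y') (hρ : ρ ≤ (z * A ^ c) ^ 3 * q)
    (hS : A * (z / c + (1 - 1 / c) * (#X' / #X)) * (excess G p X Y / #Y) ≤
      excess G p X' Y' / #Y') :
    ρ * pot G p c X Y ≤ pot G p c X' Y' := by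
  obtain ⟨hX0, hY0⟩ := card_pos_of_excess_pos h
  obtain ⟨hX0', hY0'⟩ := card_pos_of_excess_pos h'
  have := mul_mul_pow_le_mul_div_pow hc hX0 (div_nonneg h.le hY0.le) hX0' hz hA hS
  have hp : 0 ≤ pot G p c X Y := by
    rw [pot]
    have := div_nonneg (div_nonneg h.le hY0.le) hX0.le
    positivity
  calc ρ * pot G p c X Y ≤ (z * A ^ c) ^ 3 * q * pot G p c X Y := by gcongr
    _ = (z * A ^ c * (#X * (excess G p X Y / #Y / #X) ^ c)) ^ 3 * (q * #Y) := by rw [pot]; ring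
    _ ≤ _ := by
      rw [pot]
      have := div_nonneg (div_nonneg h.le hY0.le) hX0.le
      gcongr

/-- The threshold is the one at which `pot_step` applies with z = A = q = 1, so nothing is lost. -/
theorem pot_erase {p : ℝ} {c : ℕ} {X Y : Finset V} {x : V} (hc : 1 ≤ c)
    (h : 0 < excess G p X Y) (hx : x ∈ X)
    (hlow : (#(nbr G x Y) : ℝ) - p * #Y < (1 - 1 / c) * (excess G p X Y / #Y / #X) * #Y) :
    0 < excess G p (X.erase x) Y ∧ pot G p c X Y ≤ pot G p c (X.erase x) Y := by
  obtain ⟨hX0, hY0⟩ := card_pos_of_excess_pos h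
  have hc' : (1 : ℝ) ≤ c := by exact_mod_cast hc
  have hadd : excess G p (X.erase x) Y + ((#(nbr G x Y) : ℝ) - p * #Y) = excess G p X Y :=
    sum_erase_add _ _ hx
  have hcard : (#(X.erase x) : ℝ) = #X - 1 := by
    rw [card_erase_of_mem hx, Nat.cast_sub (card_pos.2 ⟨x, hx⟩), Nat.cast_one]
  have hS : (1 : ℝ) * (1 / c + (1 - 1 / c) * (#(X.erase x) / #X)) * (excess G p X Y / #Y) ≤
      excess G p (X.erase x) Y / #Y := by
    rw [le_div_iff₀ hY0, hcard]
    have e : (1 : ℝ) * (1 / c + (1 - 1 / c) * ((#X - 1) / #X)) * (excess G p X Y / #Y) * #Y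
      = excess G p X Y - (1 - 1 / c) * (excess G p X Y / #Y / #X) * #Y := by
      field_simp
      ring
    rw [e]
    linarith
  have hpos : 0 < excess G p (X.erase x) Y := by
    by_contra! hneg
    have h1 : excess G p (X.erase x) Y / #Y ≤ 0 := div_nonpos_of_nonpos_of_nonneg hneg hY0.le
    have h2 : 0 < excess G p X Y / #Y := by positivity
    have h3 : (0 : ℝ) < 1 * (1 / c + (1 - 1 / c) * (#(X.erase x) / #X)) := by
      have : 1 / (c : ℝ) ≤ 1 := (div_le_one (by linarith)).2 hc'
      have : 0 ≤ (1 - 1 / (c : ℝ)) * (#(X.erase x) / #X) :=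
        mul_nonneg (by linarith) (div_nonneg (Nat.cast_nonneg _) hX0.le)
      have : 0 < 1 / (c : ℝ) := by positivity
      linarith
    linarith [mul_pos h3 h2]
  refine ⟨hpos, ?_⟩
  have := pot_step (q := 1) (ρ := 1) hc h hpos zero_le_one zero_le_one zero_le_one (by simp)
    (by simp) hS
  linarith

/-- When no vertex can be deleted, every T in X keeps the excess density up to a factor 1 - 1/c,
paid once per book; Y does not shrink. -/
theorem pot_book {p κ σ : ℝ} {c b : ℕ} {X Y T : Finset V} (hc : 2 ≤ c) (hκ : 0 < κ)
    (h : 0 < excess G p X Y) (hTX : T ⊆ X) (hT : κ * #X ≤ #T)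
    (hdeg : ∀ x ∈ X, (1 - 1 / c) * (excess G p X Y / #Y / #X) * #Y ≤ #(nbr G x Y) - p * #Y)
    (hσ : σ ^ b ≤ (κ * (1 - 1 / c) ^ c) ^ 3) :
    0 < excess G p T Y ∧ σ ^ b * pot G p c X Y ≤ pot G p c T Y := by
  obtain ⟨hX0, hY0⟩ := card_pos_of_excess_pos h
  have hT0 : (0 : ℝ) < #T := lt_of_lt_of_le (by positivity) hT
  have hc' : (2 : ℝ) ≤ c := by exact_mod_cast hc
  have hc1 : 0 < 1 - 1 / (c : ℝ) := by
    have : 1 / (c : ℝ) < 1 := (div_lt_one (by linarith)).2 (by linarith)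
    linarith
  have h1 : #T * ((1 - 1 / c) * (excess G p X Y / #Y / #X) * #Y) ≤ excess G p T Y := by
    rw [← nsmul_eq_mul]
    exact card_nsmul_le_sum _ _ _ fun x hx => hdeg x (hTX hx)
  have hpos : 0 < excess G p T Y := lt_of_lt_of_le (by positivity) h1
  refine ⟨hpos, ?_⟩
  have h2 : (1 - 1 / c) * (excess G p X Y / #Y / #X) ≤ excess G p T Y / #Y / #T := by
    rw [le_div_iff₀ hT0, le_div_iff₀ hY0]
    linarith
  calc σ ^ b * pot G p c X Y ≤ (κ * (1 - 1 / c) ^ c) ^ 3 * pot G p c X Y := by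
        gcongr
        rw [pot]; positivity
    _ = (κ * #X * ((1 - 1 / c) * (excess G p X Y / #Y / #X)) ^ c) ^ 3 * #Y := by
        rw [pot, mul_pow (1 - 1 / (c : ℝ))]; ring
    _ ≤ _ := by rw [pot]; gcongr

/-! ### The algorithm as an induction on X -/

/-- In a step with centre `x`, one of the two sides keeps enough of the excess. -/
theorem red_or_blue {μ A B η r β S SR SB c : ℝ} (hA : 0 ≤ A) (hAB : A ≤ B)
    (hc : 1 ≤ c) (hsum : A * (1 - μ) + B * μ ≤ 1 - η) (hrβ : r + β ≤ 1) (hβ : β ≤ μ) (hS : 0 ≤ S)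
    (h : (1 - η) * S ≤ SR + SB) :
    A * ((1 - μ) / c + (1 - 1 / c) * r) * S ≤ SR ∨ B * (μ / c + (1 - 1 / c) * β) * S ≤ SB := by
  by_contra! hcon
  have hc1 : 0 ≤ 1 - 1 / c := by
    have : 1 / c ≤ 1 := (div_le_one (by linarith)).2 hc
    linarith
  have h1 : A * ((1 - μ) / c + (1 - 1 / c) * r) + B * (μ / c + (1 - 1 / c) * β) ≤ 1 - η := by
    -- Since A ≤ B, the left side is largest when β takes its maximal value μ and r = 1 - μ.
    have h2 : A * r + B * β ≤ A * (1 - μ) + B * μ := by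
      have : A * r ≤ A * (1 - β) := by gcongr; linarith
      have : 0 ≤ (B - A) * (μ - β) := mul_nonneg (by linarith) (by linarith)
      linarith
    have h3 := mul_le_mul_of_nonneg_left h2 hc1
    calc A * ((1 - μ) / c + (1 - 1 / c) * r) + B * (μ / c + (1 - 1 / c) * β)
        = (A * (1 - μ) + B * μ) / c + (1 - 1 / c) * (A * r + B * β) := by ring
      _ ≤ (A * (1 - μ) + B * μ) / c + (1 - 1 / c) * (A * (1 - μ) + B * μ) := by linarith
      _ = A * (1 - μ) + B * μ := by ring
      _ ≤ _ := hsum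
  have h4 := mul_le_mul_of_nonneg_right h1 hS
  linarith

/-- A pair of large potential contains a red clique of size `a`, or a blue clique of size `b` in
its first part, or a blue clique of size `l` in its second part. -/
theorem exists_clique_of_pot (G : SimpleGraph V) {p μ A B η x₀ y₀ σ D : ℝ} {c b₀ M w k l : ℕ}
    (hp : 0 < p) (hμ0 : 0 < μ) (hμ1 : μ < 1) (hA : 0 < A) (hAB : A ≤ B)
    (hη0 : 0 < η) (hη1 : η < 1) (hsum : A * (1 - μ) + B * μ ≤ 1 - η) (hc : 2 ≤ c)
    (hx₀ : 0 < x₀) (hy₀ : 0 < y₀) (hxy : x₀ + y₀ ≤ 1) (hσ0 : 0 < σ) (hσ1 : σ ≤ 1)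
    (hred : x₀ ≤ ((1 - μ) * A ^ c) ^ 3 * p) (hblue : σ ≤ (μ * B ^ c) ^ 3 * p)
    (hbook : σ ^ b₀ ≤ (μ ^ b₀ / 2 * (1 - 1 / c) ^ c) ^ 3)
    (hb₀ : 0 < b₀) (hM : 2 * (b₀ : ℝ) ^ 2 < μ ^ b₀ * M)
    (hw : ∀ a ≤ k, ∀ S : Finset V, w ≤ #S →
      (∃ t ⊆ S, G.IsNClique a t) ∨ ∃ t ⊆ S, Gᶜ.IsNClique M t)
    (hD0 : 0 < D) (hD : w < (η * D - 1) * p)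
    (X Y : Finset V) (a b : ℕ) (ha : a ≤ k) (hexc : 0 < excess G p X Y)
    (hpot : D ^ 3 * (x₀⁻¹ ^ a * σ⁻¹ ^ b * y₀⁻¹ ^ l) ≤ pot G p c X Y) :
    (∃ t ⊆ X ∪ Y, G.IsNClique a t) ∨ (∃ t ⊆ X, Gᶜ.IsNClique b t) ∨
      ∃ t ⊆ Y, Gᶜ.IsNClique l t := by
  induction X using Finset.strongInduction generalizing Y a b with
  | H X ih =>
  rcases Nat.eq_zero_or_pos a with rfl | ha0
  · exact Or.inl ⟨∅, by simp, by simp [SimpleGraph.isNClique_iff]⟩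
  rcases Nat.eq_zero_or_pos b with rfl | hb0
  · exact Or.inr (Or.inl ⟨∅, by simp, by simp [SimpleGraph.isNClique_iff]⟩)
  obtain ⟨hX0, hY0⟩ := card_pos_of_excess_pos hexc
  have hS0 : 0 < excess G p X Y / #Y := div_pos hexc hY0
  have hc1 : 1 ≤ c := by omega
  have hc' : (2 : ℝ) ≤ c := by exact_mod_cast hc
  have hcinv : 1 / (c : ℝ) < 1 := (div_lt_one (by linarith)).2 (by linarith)
  have hcinv0 : 0 < 1 / (c : ℝ) := by positivity
  have hp0 : 0 ≤ pot G p c X Y := by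
    rw [pot]; positivity
  -- Termination: the potential is at most D^3 |Y|. Red steps and Erdős–Szekeres share the weight
  -- x₀, so it does not matter how many red vertices are still missing; the unspent factor σ^(-b) ≥
  -- 1 is dropped.
  by_cases hterm : excess G p X Y / #Y ≤ D
  · have h1 := hpot.trans (pot_le hp.le hc1 hexc.le hterm)
    have h2 : x₀⁻¹ ^ a * σ⁻¹ ^ b * y₀⁻¹ ^ l ≤ #Y := le_of_mul_le_mul_left h1 (by positivity)
    have h3 : x₀⁻¹ ^ a * y₀⁻¹ ^ l ≤ #Y + 1 := by
      have h4 : 1 ≤ σ⁻¹ ^ b := one_le_pow₀ ((one_le_inv₀ hσ0).2 hσ1)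
      have h5 : x₀⁻¹ ^ a * 1 * y₀⁻¹ ^ l ≤ x₀⁻¹ ^ a * σ⁻¹ ^ b * y₀⁻¹ ^ l := by gcongr
      linarith
    rcases exists_clique_or_indep G hx₀ hy₀ hxy a l Y h3 with ⟨t, ht, h⟩ | h
    · exact Or.inl ⟨t, ht.trans subset_union_right, h⟩
    · exact Or.inr (Or.inr h)
  push Not at hterm
  by_cases hlow : ∃ x ∈ X,
      (#(nbr G x Y) : ℝ) - p * #Y < (1 - 1 / c) * (excess G p X Y / #Y / #X) * #Y
  · obtain ⟨x, hx, hlow⟩ := hlow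
    obtain ⟨h1, h2⟩ := pot_erase hc1 hexc hx hlow
    have hsub := erase_subset x X
    rcases ih _ (erase_ssubset hx) Y a b ha h1 (hpot.trans h2) with
      ⟨t, ht, h⟩ | ⟨t, ht, h⟩ | h
    · exact Or.inl ⟨t, ht.trans (union_subset_union_left hsub), h⟩
    · exact Or.inr (Or.inl ⟨t, ht.trans hsub, h⟩)
    · exact Or.inr (Or.inr h)
  push Not at hlow
  set W := {x ∈ X | μ * #X ≤ #(nbr Gᶜ x X)} with hW
  have hWX : W ⊆ X := filter_subset _ _
  by_cases hWw : w ≤ #W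
  · rcases hw a ha W hWw with ⟨t, ht, h⟩ | ⟨S, hSW, hS⟩
    · exact Or.inl ⟨t, ht.trans (hWX.trans subset_union_left), h⟩
    obtain ⟨S', hS'S, hS'b, T, hTX, hST, hT⟩ := exists_book Gᶜ hμ0 hμ1.le
      (card_pos.1 (by exact_mod_cast hX0) : X.Nonempty) hb₀
      (fun s hs => (mem_filter.1 (hSW hs)).2) (by rw [hS.card_eq]; exact hM)
    have hS'c : Gᶜ.IsNClique b₀ S' := ⟨hS.isClique.subset (by exact_mod_cast hS'S), hS'b⟩
    have hS'X : S' ⊆ X := hS'S.trans (hSW.trans hWX)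
    -- If at most b₀ blue vertices are missing, the spine alone supplies them; otherwise the
    -- induction continues in the pages T.
    by_cases hbb : b ≤ b₀
    · obtain ⟨t, ht, htb⟩ := exists_subset_card_eq (hbb.trans hS'b.ge)
      exact Or.inr (Or.inl ⟨t, ht.trans hS'X, hS'c.isClique.subset (by exact_mod_cast ht), htb⟩)
    push Not at hbb
    have hTs : T ⊂ X := by
      obtain ⟨s, hs⟩ : S'.Nonempty := card_pos.1 (by omega)
      refine (ssubset_iff_of_subset hTX).2 ⟨s, hS'X hs, fun h => ?_⟩
      exact Gᶜ.loopless.irrefl s (hST s h s hs)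
    obtain ⟨h1, h2⟩ := pot_book (κ := μ ^ b₀ / 2) hc (by positivity) hexc hTX hT hlow hbook
    have h3 : D ^ 3 * (x₀⁻¹ ^ a * σ⁻¹ ^ (b - b₀) * y₀⁻¹ ^ l) ≤ pot G p c T Y := by
      refine le_trans ?_ h2
      refine le_trans (le_of_eq ?_) (mul_le_mul_of_nonneg_left hpot (by positivity))
      obtain ⟨d, rfl⟩ := Nat.exists_eq_add_of_lt hbb
      rw [show b₀ + d + 1 - b₀ = d + 1 by omega, show b₀ + d + 1 = b₀ + (d + 1) by ring,
        pow_add σ⁻¹ b₀]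
      have : σ ^ b₀ * σ⁻¹ ^ b₀ = 1 := by rw [← mul_pow, mul_inv_cancel₀ hσ0.ne', one_pow]
      linear_combination (-(D ^ 3 * (x₀⁻¹ ^ a * σ⁻¹ ^ (d + 1) * y₀⁻¹ ^ l))) * this
    rcases ih T hTs Y a (b - b₀) ha h1 h3 with ⟨t, ht, h⟩ | ⟨t, ht, h⟩ | h
    · exact Or.inl ⟨t, ht.trans (union_subset_union_left hTX), h⟩
    · refine Or.inr (Or.inl ⟨S' ∪ t, union_subset hS'X (ht.trans hTX), ?_⟩)
      have := isNClique_union hS'c h fun s hs v hv => hST v (ht hv) s hs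
      rwa [Nat.add_sub_cancel' hbb.le] at this
    · exact Or.inr (Or.inr h)
  push Not at hWw
  have hdegp : ∀ x ∈ X, p * #Y < #(nbr G x Y) := by
    intro x hx
    have h1 := hlow x hx
    have h2 : 0 < (1 - 1 / (c : ℝ)) * (excess G p X Y / #Y / #X) * #Y := by
      have : 0 < 1 - 1 / (c : ℝ) := by linarith
      positivity
    linarith
  have hlarge : #W * #Y < (η * (excess G p X Y / #Y) - 1) * p * #Y := by
    refine mul_lt_mul_of_pos_right ?_ hY0
    have : (#W : ℝ) < w := by exact_mod_cast hWw
    have h1 : η * D ≤ η * (excess G p X Y / #Y) := by gcongr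
    have h2 : (η * D - 1) * p ≤ (η * (excess G p X Y / #Y) - 1) * p := by gcongr
    linarith
  obtain ⟨x, hx, hxF⟩ := exists_central hp hη0 hη1.le hWX
    (card_pos.1 (by exact_mod_cast hY0) : Y.Nonempty) (fun x hx => (hdegp x hx).le) hlarge
  obtain ⟨hxX, hxW⟩ := mem_sdiff.1 hx
  have hβ : (#(nbr Gᶜ x X) : ℝ) < μ * #X := by
    by_contra! h
    exact hxW (mem_filter.2 ⟨hxX, h⟩)
  have hZ0 : (0 : ℝ) < #(nbr G x Y) := lt_trans (by positivity) (hdegp x hxX)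
  have hcard : (#(nbr G x X) : ℝ) + #(nbr Gᶜ x X) + 1 = #X := by
    exact_mod_cast card_nbr_add_card_nbr_compl (G := G) hxX
  have hsplit : (1 - η) * (excess G p X Y / #Y) ≤
      excess G p (nbr G x X) (nbr G x Y) / #(nbr G x Y) +
        excess G p (nbr Gᶜ x X) (nbr G x Y) / #(nbr G x Y) := by
    rw [← add_div, le_div_iff₀ hZ0]
    exact hxF
  have hssub : ∀ H : SimpleGraph V, nbr H x X ⊂ X := fun H =>
    (ssubset_iff_of_subset (nbr_subset x X)).2 ⟨x, hxX, notMem_nbr_self x X⟩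
  rcases red_or_blue (r := #(nbr G x X) / #X) (β := #(nbr Gᶜ x X) / #X) (c := c) hA.le hAB
    (by linarith) hsum (by rw [← add_div, div_le_one hX0]; linarith)
    ((div_le_iff₀ hX0).2 hβ.le) hS0.le hsplit with h | h
  · have hpos : 0 < excess G p (nbr G x X) (nbr G x Y) := by
      have h0 : 0 < A * ((1 - μ) / c + (1 - 1 / c) * (#(nbr G x X) / #X)) *
          (excess G p X Y / #Y) := by
        have h1 : 0 ≤ (1 - 1 / (c : ℝ)) * (#(nbr G x X) / #X) :=
          mul_nonneg (by linarith) (div_nonneg (Nat.cast_nonneg _) hX0.le)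
        have h2 : 0 < (1 - μ) / (c : ℝ) := div_pos (by linarith) (by linarith)
        exact mul_pos (mul_pos hA (by linarith)) hS0
      have := h0.trans_le h
      by_contra! hneg
      exact absurd (div_nonpos_of_nonpos_of_nonneg hneg hZ0.le) (not_le.2 this)
    have h1 := pot_step hc1 hexc hpos (by linarith) hA.le hp.le (hdegp x hxX).le hred h
    have h2 : D ^ 3 * (x₀⁻¹ ^ (a - 1) * σ⁻¹ ^ b * y₀⁻¹ ^ l)
        ≤ pot G p c (nbr G x X) (nbr G x Y) := by
      refine le_trans ?_ h1
      refine le_trans (le_of_eq ?_) (mul_le_mul_of_nonneg_left hpot hx₀.le)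
      obtain ⟨d, rfl⟩ := Nat.exists_eq_add_of_lt ha0
      rw [zero_add, Nat.add_sub_cancel, pow_succ x₀⁻¹ d]
      field_simp
    rcases ih _ (hssub G) (nbr G x Y) (a - 1) b (by omega) hpos h2 with
      ⟨t, ht, h⟩ | ⟨t, ht, h⟩ | ⟨t, ht, h⟩
    · refine Or.inl ⟨insert x t, insert_subset (mem_union_left _ hxX) (ht.trans
        (union_subset_union (nbr_subset x X) (nbr_subset x Y))), ?_⟩
      have := h.insert (a := x) fun v hv => by
        rcases mem_union.1 (ht hv) with hv | hv <;> exact (mem_nbr.1 hv).2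
      rwa [Nat.sub_add_cancel ha0] at this
    · exact Or.inr (Or.inl ⟨t, ht.trans (nbr_subset x X), h⟩)
    · exact Or.inr (Or.inr ⟨t, ht.trans (nbr_subset x Y), h⟩)
  · have hB : 0 < B := hA.trans_le hAB
    have hpos : 0 < excess G p (nbr Gᶜ x X) (nbr G x Y) := by
      have h0 : 0 < B * (μ / c + (1 - 1 / c) * (#(nbr Gᶜ x X) / #X)) *
          (excess G p X Y / #Y) := by
        have h1 : 0 ≤ (1 - 1 / (c : ℝ)) * (#(nbr Gᶜ x X) / #X) :=
          mul_nonneg (by linarith) (div_nonneg (Nat.cast_nonneg _) hX0.le)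
        have h2 : 0 < μ / (c : ℝ) := div_pos hμ0 (by linarith)
        exact mul_pos (mul_pos hB (by linarith)) hS0
      have := h0.trans_le h
      by_contra! hneg
      exact absurd (div_nonpos_of_nonpos_of_nonneg hneg hZ0.le) (not_le.2 this)
    have h1 := pot_step hc1 hexc hpos hμ0.le hB.le hp.le (hdegp x hxX).le hblue h
    have h2 : D ^ 3 * (x₀⁻¹ ^ a * σ⁻¹ ^ (b - 1) * y₀⁻¹ ^ l)
        ≤ pot G p c (nbr Gᶜ x X) (nbr G x Y) := by
      refine le_trans ?_ h1
      refine le_trans (le_of_eq ?_) (mul_le_mul_of_nonneg_left hpot hσ0.le)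
      obtain ⟨d, rfl⟩ := Nat.exists_eq_add_of_lt hb0
      rw [zero_add, Nat.add_sub_cancel, pow_succ σ⁻¹ d]
      field_simp
    rcases ih _ (hssub Gᶜ) (nbr G x Y) a (b - 1) ha hpos h2 with
      ⟨t, ht, h⟩ | ⟨t, ht, h⟩ | ⟨t, ht, h⟩
    · exact Or.inl ⟨t, ht.trans (union_subset_union (nbr_subset x X) (nbr_subset x Y)), h⟩
    · refine Or.inr (Or.inl ⟨insert x t, insert_subset hxX (ht.trans (nbr_subset x X)), ?_⟩)
      have := h.insert (a := x) fun v hv => (mem_nbr.1 (ht hv)).2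
      rwa [Nat.sub_add_cancel hb0] at this
    · exact Or.inr (Or.inr ⟨t, ht.trans (nbr_subset x Y), h⟩)

/-! ### Constants and asymptotics -/

/-- Erdős–Szekeres with the unbalanced weights 1 - 1/(2k) and 1/(2k): for fixed M, polynomially many
vertices suffice. -/
theorem exists_clique_or_indep_of_poly_le {V : Type} (G : SimpleGraph V) {k M a : ℕ} (hk : 1 ≤ k)
    (ha : a ≤ k) (S : Finset V) (hS : 2 * (2 * k) ^ M ≤ #S) :
    (∃ t ⊆ S, G.IsNClique a t) ∨ ∃ t ⊆ S, Gᶜ.IsNClique M t := by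
  have hk' : (1 : ℝ) ≤ k := by exact_mod_cast hk
  have h2k : 1 / (2 * k : ℝ) ≤ 1 / 2 := by gcongr; linarith
  have h2k0 : 0 < 1 / (2 * k : ℝ) := by positivity
  refine exists_clique_or_indep G (x := 1 - 1 / (2 * k)) (y := 1 / (2 * k)) (by linarith) h2k0
    (by linarith) a M S ?_
  have h1 : (1 : ℝ) / 2 ≤ (1 - 1 / (2 * k)) ^ a := by
    have hb := one_add_mul_le_pow (a := -(1 / (2 * k) : ℝ)) (by linarith) k
    have e : 1 + (k : ℝ) * -(1 / (2 * k)) = 1 / 2 := by field_simp; norm_num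
    rw [e, ← sub_eq_add_neg] at hb
    exact hb.trans (pow_le_pow_of_le_one (by linarith) (by linarith) ha)
  have h2 : (1 - 1 / (2 * k : ℝ))⁻¹ ^ a ≤ 2 := by
    rw [inv_pow]
    exact (inv_anti₀ (by norm_num) h1).trans (by norm_num)
  have h3 : (2 * (2 * k) ^ M : ℝ) ≤ #S := by exact_mod_cast hS
  calc (1 - 1 / (2 * k : ℝ))⁻¹ ^ a * (1 / (2 * k : ℝ))⁻¹ ^ M ≤ 2 * (2 * k) ^ M := by
        rw [one_div (2 * k : ℝ), inv_inv, ← one_div (2 * k : ℝ)]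
        gcongr
    _ ≤ #S + 1 := by linarith

theorem eventually_poly_le (M : ℕ) (C : ℝ) :
    ∀ᶠ k : ℕ in Filter.atTop, C * (k : ℝ) ^ M ≤
      ((3.993 : ℝ) ^ 4 * (0.055 * 0.945 * 0.0765)) ^ k := by
  have h := tendsto_pow_const_div_const_pow_of_one_lt M
    (r := (3.993 : ℝ) ^ 4 * (0.055 * 0.945 * 0.0765)) (by norm_num)
  have h0 : (0 : ℝ) < 1 / (|C| + 1) := by positivity
  filter_upwards [h.eventually_lt_const h0] with k hk
  rw [div_lt_div_iff₀ (by positivity) (by positivity)] at hk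
  have : C * (k : ℝ) ^ M ≤ (|C| + 1) * k ^ M := by
    gcongr
    linarith [le_abs_self C]
  linarith

theorem exists_clique_of_excess : ∃ k₀ : ℕ, ∀ k N : ℕ, k₀ ≤ k → (3.993 : ℝ) ^ k / 2 ≤ N →
    ∀ G : SimpleGraph (Fin N), 0.0005 * (N : ℝ) ^ 2 ≤ excess G 0.499 univ univ →
      (∃ t, G.IsNClique k t) ∨ ∃ t, Gᶜ.IsNClique k t := by
  -- The spine size 150 is long enough for the gap between σ = 0.0765 and μ^3 ≈ 0.0795 to absorb the
  -- fixed loss ((1/2)(19/20)^20)^3 of a book.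
  obtain ⟨M, hM⟩ := exists_nat_gt (2 * ((150 : ℕ) : ℝ) ^ 2 / 0.43 ^ 150)
  rw [div_lt_iff₀' (by positivity)] at hM
  obtain ⟨k₀, hk₀⟩ := Filter.eventually_atTop.1
    (eventually_poly_le (M * 3) (160000 ^ 3 * (2 ^ M) ^ 3 * 16 * 2000 ^ 60))
  refine ⟨k₀ + 1, fun k N hk hNk G hG => ?_⟩
  have hmain := hk₀ k (by omega)
  have hN0 : (0 : ℝ) < N := lt_of_lt_of_le (by positivity) hNk
  have hk1 : (1 : ℝ) ≤ k := by exact_mod_cast (by omega : 1 ≤ k)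
  have hpow1 : (1 : ℝ) ≤ (2 * k) ^ M := one_le_pow₀ (by linarith)
  have hexc : 0 < excess G 0.499 univ univ := lt_of_lt_of_le (by positivity) hG
  have hpot : (160000 * (2 * k : ℝ) ^ M) ^ 3 *
      ((0.055 : ℝ)⁻¹ ^ k * (0.0765 : ℝ)⁻¹ ^ k * (0.945 : ℝ)⁻¹ ^ k) ≤ pot G 0.499 20 univ univ := by
    have hlow : (0.0005 : ℝ) ≤ excess G 0.499 univ univ / N / N := by
      rw [le_div_iff₀ hN0, le_div_iff₀ hN0]
      linarith
    have h1 : (N : ℝ) ^ 4 * 0.0005 ^ 60 ≤ pot G 0.499 20 univ univ := by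
      rw [pot, card_univ, Fintype.card_fin]
      calc (N : ℝ) ^ 4 * 0.0005 ^ 60 = (N * 0.0005 ^ 20) ^ 3 * N := by ring
        _ ≤ _ := by gcongr
    refine le_trans ?_ h1
    have h2 : ((3.993 : ℝ) ^ k / 2) ^ 4 * 0.0005 ^ 60 ≤ (N : ℝ) ^ 4 * 0.0005 ^ 60 := by gcongr
    refine le_trans ?_ h2
    rw [← mul_pow, ← mul_pow]
    have h3 : (0 : ℝ) < (0.055⁻¹ * 0.0765⁻¹ * 0.945⁻¹) ^ k := by positivity
    have h4 := mul_le_mul_of_nonneg_right hmain h3.le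
    rw [← mul_pow ((3.993 : ℝ) ^ 4 * (0.055 * 0.945 * 0.0765)),
      show ((3.993 : ℝ) ^ 4 * (0.055 * 0.945 * 0.0765)) *
      (0.055⁻¹ * 0.0765⁻¹ * 0.945⁻¹) = 3.993 ^ 4 by norm_num] at h4
    have e1 : ((3.993 : ℝ) ^ k / 2) ^ 4 * 0.0005 ^ 60 = (3.993 ^ 4) ^ k / (16 * 2000 ^ 60) := by
      rw [div_pow, ← pow_mul, ← pow_mul, mul_comm k 4, show (0.0005 : ℝ) = 1 / 2000 by norm_num,
        div_pow]
      field_simp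
      norm_num
    rw [e1, le_div_iff₀ (by positivity)]
    refine le_trans (le_of_eq ?_) h4
    rw [mul_pow (160000 : ℝ), mul_pow (2 : ℝ), mul_pow ((2 : ℝ) ^ M), ← pow_mul (k : ℝ)]
    ring
  -- A and B nearly exhaust A(1 - μ) + Bμ ≤ 1 - η, and x₀, σ lie just below the resulting step
  -- costs. D makes ηD = 8(2k)^M, so that (ηD - 1)p exceeds w = 2(2k)^M.
  have hres := exists_clique_of_pot G (p := 0.499) (μ := 0.43) (A := 0.9915) (B := 1.0111)
    (η := 1 / 20000) (x₀ := 0.055) (y₀ := 0.945) (σ := 0.0765) (D := 160000 * (2 * k) ^ M)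
    (c := 20) (b₀ := 150) (M := M) (w := 2 * (2 * k) ^ M) (k := k) (l := k)
    (by norm_num) (by norm_num) (by norm_num) (by norm_num) (by norm_num) (by norm_num)
    (by norm_num) (by norm_num) (by norm_num) (by norm_num) (by norm_num) (by norm_num)
    (by norm_num) (by norm_num) (by norm_num) (by norm_num) (by norm_num) (by norm_num) hM
    (fun a ha S hS => exists_clique_or_indep_of_poly_le G (by omega) ha S hS)
    (by positivity) (by push_cast; linarith) univ univ k k le_rfl hexc hpot
  rcases hres with ⟨t, -, h⟩ | ⟨t, -, h⟩ | ⟨t, -, h⟩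
  exacts [Or.inl ⟨t, h⟩, Or.inr ⟨t, h⟩, Or.inr ⟨t, h⟩]

theorem excess_add_excess_compl {V : Type} [Fintype V] (G : SimpleGraph V) (p : ℝ) :
    excess G p univ univ + excess Gᶜ p univ univ =
      Fintype.card V * (Fintype.card V * (1 - 2 * p) - 1) := by
  rw [excess, excess, ← sum_add_distrib,
    sum_congr rfl (g := fun _ => (Fintype.card V * (1 - 2 * p) - 1 : ℝ))]
  · simp [mul_sub]
  · intro x _
    have : (#(nbr G x univ) : ℝ) + #(nbr Gᶜ x univ) + 1 = Fintype.card V := by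
      exact_mod_cast card_nbr_add_card_nbr_compl (G := G) (mem_univ x)
    rw [card_univ]
    linarith

theorem exists_mono_clique : ∃ k₀ : ℕ, ∀ k N : ℕ, k₀ ≤ k → (3.993 : ℝ) ^ k / 2 ≤ N →
    ∀ G : SimpleGraph (Fin N), (∃ t, G.IsNClique k t) ∨ ∃ t, Gᶜ.IsNClique k t := by
  obtain ⟨k₀, hk₀⟩ := exists_clique_of_excess
  refine ⟨k₀ + 6, fun k N hk hNk G => ?_⟩
  have h1 := hk₀ k N (by omega) hNk G
  have h2 := hk₀ k N (by omega) hNk Gᶜ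
  have hN : (1000 : ℝ) ≤ N := by
    have : (3.993 : ℝ) ^ 6 ≤ 3.993 ^ k := pow_le_pow_right₀ (by norm_num) (by omega)
    have h6 : (2000 : ℝ) ≤ 3.993 ^ 6 := by norm_num
    linarith
  have h3 := excess_add_excess_compl G 0.499
  rw [Fintype.card_fin] at h3
  -- The two excesses sum to 0.002 N² - N ≥ 0.001 N², so one colour has at least half of that.
  have h4 : 1000 * (N : ℝ) ≤ N * N := by gcongr
  by_cases hG : 0.0005 * (N : ℝ) ^ 2 ≤ excess G 0.499 univ univ
  · exact h1 hG
  · rw [compl_compl] at h2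
    exact (h2 (by linarith)).symm

/-! ### From graphs to colourings, and small k -/

theorem ramseyProperty_of_forall_graph {k N : ℕ}
    (h : ∀ G : SimpleGraph (Fin N), (∃ t, G.IsNClique k t) ∨ ∃ t, Gᶜ.IsNClique k t) :
    RamseyProperty k N := by
  intro c
  have hc : (c.labelGraph 0)ᶜ = c.labelGraph 1 := by
    ext x y
    rw [SimpleGraph.compl_adj]
    simp only [SimpleGraph.TopEdgeLabeling.labelGraph_adj]
    constructor
    · rintro ⟨hxy, hn⟩
      refine ⟨hxy, ?_⟩
      have : c.get x y hxy ≠ 0 := fun h => hn ⟨hxy, h⟩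
      omega
    · rintro ⟨hxy, h⟩
      refine ⟨hxy, ?_⟩
      rintro ⟨_, h'⟩
      rw [h] at h'
      exact absurd h' (by decide)
  rcases h (c.labelGraph 0) with ⟨t, ht⟩ | ⟨t, ht⟩
  · exact ⟨0, t, ht⟩
  · exact ⟨1, t, hc ▸ ht⟩

theorem ramseyNumber_lt_four_pow (k : ℕ) : ramseyNumber k < 4 ^ k := by
  have h0 : 0 < 4 ^ k := by positivity
  have h : RamseyProperty k (4 ^ k - 1) := by
    refine ramseyProperty_of_forall_graph fun G => ?_
    have h1 := exists_clique_or_indep G (x := 1 / 2) (y := 1 / 2) (by norm_num) (by norm_num)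
      (by norm_num) k k univ (by
        rw [card_univ, Fintype.card_fin, Nat.cast_sub h0, ← mul_pow]
        norm_num)
    simpa using h1
  have := (ramseyNumber_isLeast k).2 h
  omega

theorem exists_sub_pow_bound (k₀ : ℕ) : ∃ δ : ℝ, 0 < δ ∧ δ ≤ 0.007 ∧
    ∀ k < k₀, (ramseyNumber k : ℝ) ≤ (4 - δ) ^ k := by
  have hC : (1 : ℝ) ≤ (k₀ + 1) * 4 ^ k₀ :=
    one_le_mul_of_one_le_of_one_le (by linarith [(Nat.cast_nonneg k₀ : (0 : ℝ) ≤ k₀)])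
      (one_le_pow₀ (by norm_num))
  -- Small k are handled by r(k) ≤ 4^k - 1: this δ is so small that 4^k - (4 - δ)^k ≤ 1 for k < k₀
  -- by Bernoulli. The cap 0.007 gives 3.993 ≤ 4 - δ for large k.
  refine ⟨0.007 / ((k₀ + 1) * 4 ^ k₀), by positivity, div_le_self (by norm_num) hC,
    fun k hk => ?_⟩
  have h1 : (ramseyNumber k : ℝ) + 1 ≤ 4 ^ k := by
    exact_mod_cast ramseyNumber_lt_four_pow k
  set δ : ℝ := 0.007 / ((k₀ + 1) * 4 ^ k₀) with hδ
  have hδ0 : 0 < δ := by positivity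
  have hδ1 : δ ≤ 0.007 := div_le_self (by norm_num) hC
  have hb := one_add_mul_le_pow (a := -(δ / 4)) (by linarith) k
  have hk' : (k : ℝ) ≤ k₀ + 1 := by
    have : (k : ℝ) < k₀ := by exact_mod_cast hk
    linarith
  have h4 : (4 : ℝ) ^ k ≤ 4 ^ k₀ := pow_le_pow_right₀ (by norm_num) hk.le
  have h2 : (4 : ℝ) ^ k * (k * δ) ≤ 0.007 :=
    calc (4 : ℝ) ^ k * (k * δ) ≤ 4 ^ k₀ * ((k₀ + 1) * δ) := by gcongr
      _ = 0.007 := by rw [hδ]; field_simp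
  calc (ramseyNumber k : ℝ) ≤ 4 ^ k * (1 + k * -(δ / 4)) := by linarith
    _ ≤ 4 ^ k * (1 + -(δ / 4)) ^ k := by gcongr
    _ = (4 - δ) ^ k := by rw [← mul_pow]; ring

end RamseyBook


theorem theorem1p4 :
    (∃ δ : ℝ, 0 < δ ∧ ∀ k : ℕ, 2 ≤ k → (ramseyNumber k : ℝ) ≤ (4 - δ) ^ k) ∧
    (∃ k₀ : ℕ, ∀ k : ℕ, k₀ ≤ k → (ramseyNumber k : ℝ) ≤ (3.993 : ℝ) ^ k) := by
  obtain ⟨k₀, hk₀⟩ := RamseyBook.exists_mono_clique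
  have hlarge : ∀ k : ℕ, k₀ ≤ k → (ramseyNumber k : ℝ) ≤ (3.993 : ℝ) ^ k := by
    intro k hk
    have h1 : (1 : ℝ) ≤ 3.993 ^ k := one_le_pow₀ (by norm_num)
    -- A real number that is at least 1 is less than twice its floor; the factor 1/2 in
    -- `exists_mono_clique` pays for this rounding.
    have h2 : (1 : ℝ) ≤ ⌊(3.993 : ℝ) ^ k⌋₊ := by exact_mod_cast (Nat.one_le_floor_iff _).2 h1
    have h3 := Nat.lt_floor_add_one ((3.993 : ℝ) ^ k)
    calc (ramseyNumber k : ℝ) ≤ ⌊(3.993 : ℝ) ^ k⌋₊ := by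
          exact_mod_cast (ramseyNumber_isLeast k).2
            (RamseyBook.ramseyProperty_of_forall_graph (hk₀ k _ hk (by linarith)))
      _ ≤ 3.993 ^ k := Nat.floor_le (by positivity)
  refine ⟨?_, k₀, hlarge⟩
  obtain ⟨δ, h0, h1, hδ⟩ := RamseyBook.exists_sub_pow_bound k₀
  refine ⟨δ, h0, fun k _ => ?_⟩
  rcases lt_or_ge k k₀ with hk | hk
  · exact hδ k hk
  · exact (hlarge k hk).trans (pow_le_pow_left₀ (by norm_num) (by linarith) k)
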